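/- **Theorem 3.2.** Let $F_d\in\mathbb R^{d\times d_m}$ with $d\ge 1$ (parameter-to-observable map of all $d$ candidate sensors), let $\Gamma_{\rm pr}\in\mathbb R^{d_m\times d_m}$ be symmetric positive definite (prior covariance of the parameter $m$), let $P\in\mathbb R^{d_\rho\times d_m}$ be such that $\Sigma_{\rm pr}:=P\Gamma_{\rm pr}P^T$ is invertible (prior covariance of the quantity of interest $\rho=Pm$), and let $\Gamma_{\rm n}^d=\mathrm{diag}(\sigma_1^2,\dots,\sigma_d^2)$ with all $\sigma_i>0$ and $\sigma_{\min}^2:=\min_i\sigma_i^2$. A design is a matrix $W\in\{0,1\}^{r\times d}$ all of whose row sums equal $1$ and all of whose column sums lie in $\{0,1\}$. Put $$H_d:=F_d\Gamma_{\rm pr}F_d^T,\qquad H_d^\rho:=F_d\Gamma_{\rm pr}P^T\Sigma_{\rm pr}^{-1}P\Gamma_{\rm pr}F_d^T,\qquad \Delta H_d:=H_d-H_d^\rho,$$ $$P_\dagger:=\Gamma_{\rm pr}P^T\Sigma_{\rm pr}^{-1},\qquad \Gamma_\eta(W):=W\Gamma_{\rm n}^dW^T+WF_d\bigl(\Gamma_{\rm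 pr}-\Gamma_{\rm pr}P^T\Sigma_{\rm pr}^{-1}P\Gamma_{\rm pr}\bigr)F_d^TW^T,$$ and let the goal-oriented expected information gain (EIG) of $W$ be $$\Psi^\rho(W):=\tfrac12\log\det\Bigl(I+\Sigma_{\rm pr}^{1/2}(WF_dP_\dagger)^T\,\Gamma_\eta(W)^{-1}\,(WF_dP_\dagger)\,\Sigma_{\rm pr}^{1/2}\Bigr).$$ Let $H_d^\rho=U\,\mathrm{diag}(\zeta_1,\dots,\zeta_d)\,U^T$ and $\Delta H_d=V\,\mathrm{diag}(\lambda_1,\dots,\lambda_d)\,V^T$ be eigendecompositions with $U,V$ orthogonal, $\zeta_1\ge\dots\ge\zeta_d$ and $\lambda_1\ge\dots\ge\lambda_d$. For $0\le k,l\le d$ let $U_k$, $V_l$ consist of the first $k$ columns of $U$ and the first $l$ columns of $V$, and set $$\hat H_d^\rho:=U_k\,\mathrm{diag}(\zeta_1,\dots,\zeta_k)\,U_k^T,\qquad \Delta\hat H_d:=V_l\,\mathrm{diag}(\lambda_1,\dots,\lambda_l)\,V_l^T,\qquad \hat\Gamma_\eta(W):=W(\Gamma_{\rm n}^d+\Delta\hat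 H_d)W^T .$$ With a factorization $\hat\Gamma_\eta(W)^{-1}=\hat L\hat L^T$, $\hat L\in\mathbb R^{r\times r}$ (for instance the Cholesky factorization), let the approximate EIG be $$\hat\Psi^\rho(W):=\tfrac12\log\det\bigl(I_r+\hat L^TW\hat H_d^\rho W^T\hat L\bigr).$$ Then for every design $W$ $$\bigl|\Psi^\rho(W)-\hat\Psi^\rho(W)\bigr|\le\frac12\sum_{i=k+1}^{d}\log\Bigl(1+\frac{\zeta_i}{\sigma_{\min}^2}\Bigr)+\frac12\sum_{i=l+1}^{\min(l+k,\,d)}\log\Bigl(1+\frac{\lambda_i\,\zeta_1}{\sigma_{\min}^4}\Bigr).$$ -/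

import Mathlib

namespace GOOED

open Matrix

/-- Boolean design matrices `W ∈ ℝ^{r × d}`: the `i`-th sensor is placed at the `j`-th candidate
location iff `W i j = 1`; every sensor is placed once, every location is used at most once. -/
structure IsDesign {r d : ℕ} (W : Matrix (Fin r) (Fin d) ℝ) : Prop where
  entry : ∀ i j, W i j = 0 ∨ W i j = 1
  row_sum : ∀ i, ∑ j, W i j = 1
  col_sum : ∀ j, (∑ i, W i j = 0) ∨ (∑ i, W i j = 1)

section Model

variable {d dm dρ r : ℕ}

/-- Noise covariance `Γ_n^d = diag(σ₁², …, σ_d²)` of all candidate sensors. -/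
def noiseCov (σ : Fin d → ℝ) : Matrix (Fin d) (Fin d) ℝ :=
  diagonal fun i => σ i ^ 2

/-- `σ²_min = min(σ₁², …, σ_d²)`. -/
noncomputable def sigmaMinSq [NeZero d] (σ : Fin d → ℝ) : ℝ :=
  Finset.univ.inf' Finset.univ_nonempty fun i => σ i ^ 2

/-- Prior covariance `Σ_pr = P Γ_pr P*` of the quantity of interest `ρ = P m`. -/
def qoiPriorCov (Γpr : Matrix (Fin dm) (Fin dm) ℝ) (P : Matrix (Fin dρ) (Fin dm) ℝ) :
    Matrix (Fin dρ) (Fin dρ) ℝ :=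
  P * Γpr * Pᵀ

/-- `P_† = Γ_pr P* Σ_pr⁻¹`. -/
noncomputable def Pdagger (Γpr : Matrix (Fin dm) (Fin dm) ℝ) (P : Matrix (Fin dρ) (Fin dm) ℝ) :
    Matrix (Fin dm) (Fin dρ) ℝ :=
  Γpr * Pᵀ * (qoiPriorCov Γpr P)⁻¹

/-- Effective noise covariance
`Γ_η(W) = Γ_n(W) + F(W) (Γ_pr - Γ_pr P* Σ_pr⁻¹ P Γ_pr) F(W)*`,
with `F(W) = W F_d` and `Γ_n(W) = W Γ_n^d Wᵀ`. -/
noncomputable def etaCov (Fd : Matrix (Fin d) (Fin dm) ℝ) (Γpr : Matrix (Fin dm) (Fin dm) ℝ)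
    (P : Matrix (Fin dρ) (Fin dm) ℝ) (σ : Fin d → ℝ) (W : Matrix (Fin r) (Fin d) ℝ) :
    Matrix (Fin r) (Fin r) ℝ :=
  W * noiseCov σ * Wᵀ
    + W * Fd * (Γpr - Γpr * Pᵀ * (qoiPriorCov Γpr P)⁻¹ * P * Γpr) * (W * Fd)ᵀ

/-- Goal-oriented data-misfit Hessian `H_m^ρ(W) = (F(W) P_†)* Γ_η(W)⁻¹ F(W) P_†`. -/
noncomputable def goalHessian (Fd : Matrix (Fin d) (Fin dm) ℝ)
    (Γpr : Matrix (Fin dm) (Fin dm) ℝ) (P : Matrix (Fin dρ) (Fin dm) ℝ) (σ : Fin d → ℝ)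
    (W : Matrix (Fin r) (Fin d) ℝ) : Matrix (Fin dρ) (Fin dρ) ℝ :=
  (W * Fd * Pdagger Γpr P)ᵀ * (etaCov Fd Γpr P σ W)⁻¹ * (W * Fd * Pdagger Γpr P)

open scoped MatrixOrder Matrix.Norms.L2Operator in
/-- Goal-oriented expected information gain
`Ψ^ρ(W) = ½ log det (I + Σ_pr^{1/2} H_m^ρ(W) Σ_pr^{1/2})`. -/
noncomputable def eig (Fd : Matrix (Fin d) (Fin dm) ℝ)
    (Γpr : Matrix (Fin dm) (Fin dm) ℝ) (P : Matrix (Fin dρ) (Fin dm) ℝ) (σ : Fin d → ℝ)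
    (W : Matrix (Fin r) (Fin d) ℝ) : ℝ :=
  1 / 2 * Real.log (1 + CFC.sqrt (qoiPriorCov Γpr P) * goalHessian Fd Γpr P σ W
    * CFC.sqrt (qoiPriorCov Γpr P)).det

/-- `H_d = F_d Γ_pr F_d*`. -/
def Hd (Fd : Matrix (Fin d) (Fin dm) ℝ) (Γpr : Matrix (Fin dm) (Fin dm) ℝ) :
    Matrix (Fin d) (Fin d) ℝ :=
  Fd * Γpr * Fdᵀ

/-- `H_d^ρ = F_d Γ_pr P* Σ_pr⁻¹ P Γ_pr F_d*`. -/
noncomputable def Hdρ (Fd : Matrix (Fin d) (Fin dm) ℝ) (Γpr : Matrix (Fin dm) (Fin dm) ℝ)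
    (P : Matrix (Fin dρ) (Fin dm) ℝ) : Matrix (Fin d) (Fin d) ℝ :=
  Fd * Γpr * Pᵀ * (qoiPriorCov Γpr P)⁻¹ * P * Γpr * Fdᵀ

/-- `ΔH_d = H_d - H_d^ρ`. -/
noncomputable def ΔHd (Fd : Matrix (Fin d) (Fin dm) ℝ) (Γpr : Matrix (Fin dm) (Fin dm) ℝ)
    (P : Matrix (Fin dρ) (Fin dm) ℝ) : Matrix (Fin d) (Fin d) ℝ :=
  Hd Fd Γpr - Hdρ Fd Γpr P

end Model

section LowRank

variable {d r : ℕ}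

/-- `H = U diag(ζ) Uᵀ` is an eigendecomposition of `H`: the columns of `U` are an orthonormal
basis of eigenvectors, and the eigenvalues `ζ` are in non-increasing order. -/
structure IsEigendecomposition (H U : Matrix (Fin d) (Fin d) ℝ) (ζ : Fin d → ℝ) : Prop where
  orthogonal : Uᵀ * U = 1
  antitone : Antitone ζ
  eq : H = U * diagonal ζ * Uᵀ

/-- Truncated eigendecomposition `U_k Z_k U_kᵀ`, where `U_k` consists of the first `k` columns of
`U` and `Z_k = diag(ζ₁, …, ζ_k)`. -/
def truncation (U : Matrix (Fin d) (Fin d) ℝ) (ζ : Fin d → ℝ) {k : ℕ} (hk : k ≤ d) :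
    Matrix (Fin d) (Fin d) ℝ :=
  U.submatrix id (Fin.castLE hk) * diagonal (fun i : Fin k => ζ (Fin.castLE hk i))
    * (U.submatrix id (Fin.castLE hk))ᵀ

/-- `Γ̂_η(W) = W (Γ_n^d + ΔĤ_d) Wᵀ`. -/
def etaCovApprox (σ : Fin d → ℝ) (ΔHhat : Matrix (Fin d) (Fin d) ℝ)
    (W : Matrix (Fin r) (Fin d) ℝ) : Matrix (Fin r) (Fin r) ℝ :=
  W * (noiseCov σ + ΔHhat) * Wᵀ

/-- Approximate expected information gain `Ψ̂^ρ(W) = ½ log det (I_r + L̂ᵀ W Ĥ_d^ρ Wᵀ L̂)`. -/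
noncomputable def eigApprox (Hhat : Matrix (Fin d) (Fin d) ℝ) (Lhat : Matrix (Fin r) (Fin r) ℝ)
    (W : Matrix (Fin r) (Fin d) ℝ) : ℝ :=
  1 / 2 * Real.log (1 + Lhatᵀ * W * Hhat * Wᵀ * Lhat).det

end LowRank

end GOOED

/-!
The expected information gain of a Gaussian signal with covariance `A` in noise of covariance `C` is
`I(C, A) = ½ log det (1 + C⁻¹ A)`. It obeys the chain rule `I(C, A + A') = I(C, A) + I(C + A, A')`,
is increasing in `A` and decreasing in `C`.

With `C = W (N + ΔĤ) Wᵀ` and `C + E = W (N + ΔH) Wᵀ`, where `N ≥ s`, the error splits at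
`I(C + E, W Ĥ Wᵀ)`. Truncating the signal loses `I(C + E + W Ĥ Wᵀ, G) ≤ I(C, G)`, where `G` is the
discarded signal. Truncating the noise gains, for `W Ĥ Wᵀ = Y Yᵀ`, at most `I(1, Yᵀ C⁻¹ E C⁻¹ Y)`,
because `C⁻¹ - (C + E)⁻¹ ≤ C⁻¹ E C⁻¹`; since `Y` has only `k` columns, only the `k` largest
discarded eigenvalues contribute. Both estimates rest on `Wᵀ C⁻¹ W ≤ s⁻¹`, the Schur-complement dual
of `s W Wᵀ ≤ C`.
-/

namespace GOOED

open Matrix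
open scoped MatrixOrder

section LoewnerOrder

variable {m n : Type*}

theorem posDef_of_le {A B : Matrix n n ℝ} (hA : A.PosDef) (h : A ≤ B) : B.PosDef := by
  simpa using hA.add_posSemidef (le_iff.mp h)

theorem diagonal_le_diagonal [DecidableEq n] {a b : n → ℝ} (h : a ≤ b) :
    diagonal a ≤ diagonal b := by
  rw [le_iff, diagonal_sub]
  exact PosSemidef.diagonal fun i => sub_nonneg.mpr (h i)

theorem diagonal_nonneg [DecidableEq n] {a : n → ℝ} (h : 0 ≤ a) : 0 ≤ diagonal a := by
  simpa using diagonal_le_diagonal h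

variable [Fintype n]

theorem mul_mul_transpose_le_mul_mul_transpose [Finite m] {A B : Matrix n n ℝ} (h : A ≤ B)
    (M : Matrix m n ℝ) : M * A * Mᵀ ≤ M * B * Mᵀ := by
  have := (le_iff.mp h).mul_mul_conjTranspose_same M
  rwa [conjTranspose_eq_transpose_of_trivial, Matrix.mul_sub, Matrix.sub_mul, ← le_iff] at this

theorem transpose_mul_mul_le_transpose_mul_mul [Finite m] {A B : Matrix n n ℝ} (h : A ≤ B)
    (M : Matrix n m ℝ) : Mᵀ * A * M ≤ Mᵀ * B * M := by
  simpa using mul_mul_transpose_le_mul_mul_transpose h Mᵀ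

theorem mul_mul_transpose_nonneg [Finite m] {A : Matrix n n ℝ} (h : 0 ≤ A) (M : Matrix m n ℝ) :
    0 ≤ M * A * Mᵀ := by
  simpa using mul_mul_transpose_le_mul_mul_transpose h M

theorem transpose_mul_mul_nonneg [Finite m] {A : Matrix n n ℝ} (h : 0 ≤ A) (M : Matrix n m ℝ) :
    0 ≤ Mᵀ * A * M := by
  simpa using transpose_mul_mul_le_transpose_mul_mul h M

theorem mul_transpose_nonneg [Finite m] (M : Matrix m n ℝ) : 0 ≤ M * Mᵀ :=
  (posSemidef_self_mul_conjTranspose M).nonneg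

theorem exists_eq_mul_transpose_of_nonneg {A : Matrix n n ℝ} (h : 0 ≤ A) :
    ∃ Y : Matrix n n ℝ, A = Y * Yᵀ := by
  classical
  obtain ⟨Y, rfl⟩ := CStarAlgebra.nonneg_iff_eq_star_mul_self.mp h
  exact ⟨Yᵀ, by simp [star_eq_conjTranspose]⟩

variable [DecidableEq n]

theorem isUnit_det_of_posDef {A : Matrix n n ℝ} (hA : A.PosDef) : IsUnit A.det :=
  hA.det_pos.ne'.isUnit

theorem transpose_inv_of_posDef {A : Matrix n n ℝ} (hA : A.PosDef) : A⁻¹ᵀ = A⁻¹ := by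
  simpa using hA.inv.isHermitian.eq

theorem inv_smul_one {c : ℝ} (hc : c ≠ 0) : (c • (1 : Matrix n n ℝ))⁻¹ = c⁻¹ • 1 :=
  inv_eq_left_inv (by simp [smul_smul, hc])

/-- Both sides say that the block matrix `[A, X; Xᵀ, B]` is positive semidefinite. -/
theorem mul_inv_mul_transpose_le_iff [Fintype m] [DecidableEq m] {A : Matrix m m ℝ}
    {B : Matrix n n ℝ} (hA : A.PosDef) (hB : B.PosDef) (X : Matrix m n ℝ) :
    X * B⁻¹ * Xᵀ ≤ A ↔ Xᵀ * A⁻¹ * X ≤ B := by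
  let _ := hA.isUnit.invertible
  let _ := hB.isUnit.invertible
  exact (PosDef.fromBlocks₂₂ A X hB).symm.trans (PosDef.fromBlocks₁₁ X B hA)

theorem inv_le_inv_of_le {A B : Matrix n n ℝ} (hA : A.PosDef) (h : A ≤ B) : B⁻¹ ≤ A⁻¹ := by
  have key := mul_inv_mul_transpose_le_iff (posDef_of_le hA h) hA.inv 1
  rw [nonsing_inv_nonsing_inv _ (isUnit_det_of_posDef hA)] at key
  simpa using key.mp (by simpa using h)

/-- The inverse is operator convex, so it lies above its tangent at `A`. -/
theorem inv_sub_inv_le {A B : Matrix n n ℝ} (hA : A.PosDef) (hB : B.PosDef) :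
    A⁻¹ - B⁻¹ ≤ A⁻¹ * (B - A) * A⁻¹ := by
  have hAu := isUnit_det_of_posDef hA
  have hBu := isUnit_det_of_posDef hB
  have completed_square : (A⁻¹ - B⁻¹) * B * (A⁻¹ - B⁻¹)ᵀ = A⁻¹ * (B - A) * A⁻¹ - (A⁻¹ - B⁻¹) := by
    simp only [transpose_sub, transpose_inv_of_posDef hA, transpose_inv_of_posDef hB,
      Matrix.sub_mul, Matrix.mul_sub, nonsing_inv_mul _ hAu, nonsing_inv_mul _ hBu,
      mul_nonsing_inv_cancel_right _ _ hBu, Matrix.one_mul]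
  rw [← sub_nonneg, ← completed_square]
  exact mul_mul_transpose_nonneg hB.posSemidef.nonneg _

theorem transpose_mul_inv_mul_le [Fintype m] [DecidableEq m] {C : Matrix m m ℝ}
    (hC : C.PosDef) {W : Matrix m n ℝ} {s : ℝ} (hs : 0 < s) (h : s • (W * Wᵀ) ≤ C) :
    Wᵀ * C⁻¹ * W ≤ s⁻¹ • 1 := by
  refine (mul_inv_mul_transpose_le_iff hC (PosDef.one.smul (inv_pos.mpr hs)) W).mp ?_
  simpa [inv_smul_one (inv_ne_zero hs.ne')] using h

theorem transpose_mul_self_le_of_mul_transpose_le [Fintype m] [DecidableEq m] {M : Matrix m n ℝ}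
    {c : ℝ} (hc : 0 ≤ c) (h : M * Mᵀ ≤ c • 1) : Mᵀ * M ≤ c • 1 := by
  rcases hc.eq_or_lt with rfl | hc
  · have hM : Mᵀ = 0 := conjTranspose_mul_self_eq_zero.mp <| by
      simpa using le_antisymm (by simpa using h) (mul_transpose_nonneg M)
    simp [hM]
  · have key := mul_inv_mul_transpose_le_iff (PosDef.one.smul hc) (PosDef.one (n := n)) M
    rw [inv_smul_one hc.ne'] at key
    have := smul_le_smul_of_nonneg_left (key.mp (by simpa using h)) hc.le
    simpa [smul_smul, hc.ne'] using this

theorem mul_mul_self_le_of_le_smul_one {K A : Matrix n n ℝ} {c z : ℝ} (hK : 0 ≤ K)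
    (hKc : K ≤ c • 1) (hc : 0 ≤ c) (hA : A ≤ z • 1) (hz : 0 ≤ z) :
    K * A * K ≤ (z * c ^ 2) • 1 := by
  have hKT : Kᵀ = K := by simpa using hK.posSemidef.isHermitian.eq
  have hKK : K * K ≤ c • K := by
    have hcomm : Commute K (c • 1 - K) := by
      simp [commute_iff_eq, Matrix.mul_sub, Matrix.sub_mul]
    simpa [Matrix.mul_sub] using hcomm.mul_nonneg hK (sub_nonneg.mpr hKc)
  calc K * A * K ≤ K * (z • 1) * K := by
        simpa only [hKT] using mul_mul_transpose_le_mul_mul_transpose hA K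
    _ = z • (K * K) := by simp
    _ ≤ z • c • K := smul_le_smul_of_nonneg_left hKK hz
    _ ≤ z • c • c • 1 :=
        smul_le_smul_of_nonneg_left (smul_le_smul_of_nonneg_left hKc hc) hz
    _ = (z * c ^ 2) • 1 := by rw [smul_smul, smul_smul, mul_assoc, sq]

theorem one_le_det_one_add {A : Matrix n n ℝ} (hA : 0 ≤ A) : 1 ≤ (1 + A).det := by
  have hA := hA.posSemidef
  set Q : Matrix n n ℝ := ↑hA.1.eigenvectorUnitary
  have hQ : star Q * Q = 1 := by simp [Q]
  have spectral : A = Q * (diagonal hA.1.eigenvalues * star Q) := by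
    rw [← Matrix.mul_assoc]
    simpa [Unitary.conjStarAlgAut_apply] using hA.1.spectral_theorem
  calc 1 ≤ ∏ i, (1 + hA.1.eigenvalues i) := by
        simpa using Finset.prod_le_prod (fun i _ => zero_le_one) fun i (_ : i ∈ Finset.univ) =>
          le_add_of_nonneg_right (hA.eigenvalues_nonneg i)
    _ = (1 + diagonal hA.1.eigenvalues).det := by
        rw [← diagonal_one, diagonal_add, det_diagonal]
    _ = (1 + A).det := by
        conv_rhs => rw [spectral, det_one_add_mul_comm, Matrix.mul_assoc, hQ, Matrix.mul_one]

end LoewnerOrder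

section InfoGain

variable {m n p : Type*} [Fintype m] [DecidableEq m] [Fintype n] [DecidableEq n]
  [Fintype p] [DecidableEq p]

/-- Expected information gain (mutual information) of a Gaussian signal with covariance `A`
observed in independent Gaussian noise with covariance `C`. -/
noncomputable def infoGain (C A : Matrix m m ℝ) : ℝ :=
  1 / 2 * Real.log (1 + C⁻¹ * A).det

theorem infoGain_eq_log_det_sub_log_det {C A : Matrix m m ℝ} (hC : C.PosDef) (hA : 0 ≤ A) :
    infoGain C A = 1 / 2 * (Real.log (C + A).det - Real.log C.det) := by
  have hCA : 0 < (C + A).det := (hC.add_posSemidef hA.posSemidef).det_pos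
  have factor : (C + A).det = C.det * (1 + C⁻¹ * A).det := by
    rw [← det_mul, Matrix.mul_add, Matrix.mul_one,
      mul_nonsing_inv_cancel_left _ _ (isUnit_det_of_posDef hC)]
  rw [factor] at hCA ⊢
  rw [infoGain, Real.log_mul hC.det_pos.ne' (right_ne_zero_of_mul hCA.ne'), add_sub_cancel_left]

theorem infoGain_add {C A A' : Matrix m m ℝ} (hC : C.PosDef) (hA : 0 ≤ A) (hA' : 0 ≤ A') :
    infoGain C (A + A') = infoGain C A + infoGain (C + A) A' := by
  rw [infoGain_eq_log_det_sub_log_det hC hA,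
    infoGain_eq_log_det_sub_log_det hC (add_nonneg hA hA'),
    infoGain_eq_log_det_sub_log_det (hC.add_posSemidef hA.posSemidef) hA', add_assoc]
  ring

theorem infoGain_mul_transpose (C : Matrix m m ℝ) (Y : Matrix m n ℝ) :
    infoGain C (Y * Yᵀ) = infoGain 1 (Yᵀ * C⁻¹ * Y) := by
  rw [infoGain, infoGain, inv_one, Matrix.one_mul, ← Matrix.mul_assoc, det_one_add_mul_comm,
    Matrix.mul_assoc]

theorem infoGain_nonneg {C A : Matrix m m ℝ} (hC : C.PosDef) (hA : 0 ≤ A) :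
    0 ≤ infoGain C A := by
  obtain ⟨Y, rfl⟩ := exists_eq_mul_transpose_of_nonneg hA
  have hY := one_le_det_one_add (transpose_mul_mul_nonneg hC.inv.posSemidef.nonneg Y)
  rw [infoGain_mul_transpose, infoGain, inv_one, Matrix.one_mul]
  exact mul_nonneg (by norm_num) (Real.log_nonneg hY)

theorem infoGain_le_infoGain_right {C A A' : Matrix m m ℝ} (hC : C.PosDef) (hA : 0 ≤ A)
    (h : A ≤ A') : infoGain C A ≤ infoGain C A' := by
  have hsub := sub_nonneg.mpr h
  rw [← add_sub_cancel A A', infoGain_add hC hA hsub]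
  exact le_add_of_nonneg_right (infoGain_nonneg (hC.add_posSemidef hA.posSemidef) hsub)

theorem infoGain_le_infoGain_left {C C' A : Matrix m m ℝ} (hC : C.PosDef) (h : C ≤ C')
    (hA : 0 ≤ A) : infoGain C' A ≤ infoGain C A := by
  obtain ⟨Y, rfl⟩ := exists_eq_mul_transpose_of_nonneg hA
  rw [infoGain_mul_transpose, infoGain_mul_transpose]
  exact infoGain_le_infoGain_right PosDef.one
    (transpose_mul_mul_nonneg (posDef_of_le hC h).inv.posSemidef.nonneg Y)
    (transpose_mul_mul_le_transpose_mul_mul (inv_le_inv_of_le hC h) Y)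

theorem infoGain_add_le {C A A' : Matrix m m ℝ} (hC : C.PosDef) (hA : 0 ≤ A) (hA' : 0 ≤ A') :
    infoGain C (A + A') ≤ infoGain C A + infoGain C A' := by
  rw [infoGain_add hC hA hA']
  exact add_le_add_right (infoGain_le_infoGain_left hC (le_add_of_nonneg_right hA) hA') _

theorem infoGain_one_diagonal {a : m → ℝ} (ha : 0 ≤ a) :
    infoGain 1 (diagonal a) = 1 / 2 * ∑ i, Real.log (1 + a i) := by
  rw [infoGain, inv_one, Matrix.one_mul, ← diagonal_one, diagonal_add, det_diagonal,
    Real.log_prod fun i _ => (add_pos_of_pos_of_nonneg one_pos (ha i)).ne']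

theorem infoGain_le_infoGain_add_infoGain_one {C E : Matrix m m ℝ} (hC : C.PosDef) (hE : 0 ≤ E)
    (Y : Matrix m n ℝ) :
    infoGain C (Y * Yᵀ) ≤
      infoGain (C + E) (Y * Yᵀ) + infoGain 1 (Yᵀ * (C⁻¹ * E * C⁻¹) * Y) := by
  have hCE : (C + E).PosDef := hC.add_posSemidef hE.posSemidef
  have hgap : 0 ≤ C⁻¹ - (C + E)⁻¹ :=
    sub_nonneg.mpr (inv_le_inv_of_le hC (le_add_of_nonneg_right hE))
  have tangent : C⁻¹ - (C + E)⁻¹ ≤ C⁻¹ * E * C⁻¹ := by simpa using inv_sub_inv_le hC hCE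
  have split : Yᵀ * C⁻¹ * Y = Yᵀ * (C + E)⁻¹ * Y + Yᵀ * (C⁻¹ - (C + E)⁻¹) * Y := by
    rw [← Matrix.add_mul, ← Matrix.mul_add, add_sub_cancel]
  rw [infoGain_mul_transpose, infoGain_mul_transpose, split]
  refine (infoGain_add_le PosDef.one (transpose_mul_mul_nonneg hCE.inv.posSemidef.nonneg Y)
    (transpose_mul_mul_nonneg hgap Y)).trans (add_le_add_right ?_ _)
  exact infoGain_le_infoGain_right PosDef.one (transpose_mul_mul_nonneg hgap Y)
    (transpose_mul_mul_le_transpose_mul_mul tangent Y)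

theorem abs_infoGain_add_sub_infoGain_le {C E A G : Matrix m m ℝ} {ε δ : ℝ} (hC : C.PosDef)
    (hE : 0 ≤ E) (hA : 0 ≤ A) (hG : 0 ≤ G) (hsignal : infoGain C G ≤ ε)
    (hnoise : infoGain C A ≤ infoGain (C + E) A + δ) :
    |infoGain (C + E) (A + G) - infoGain C A| ≤ ε + δ := by
  have hCE : (C + E).PosDef := hC.add_posSemidef hE.posSemidef
  have hCEA : C ≤ C + E + A := add_assoc C E A ▸ le_add_of_nonneg_right (add_nonneg hE hA)
  have chain := infoGain_add hCE hA hG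
  have lost_nonneg := infoGain_nonneg (posDef_of_le hC hCEA) hG
  have lost_le := infoGain_le_infoGain_left hC hCEA hG
  have anti := infoGain_le_infoGain_left hC (le_add_of_nonneg_right hE) hA
  rw [abs_le]
  constructor <;> linarith

theorem infoGain_mul_diagonal_mul_transpose_le {C : Matrix m m ℝ} (hC : C.PosDef)
    {X : Matrix m p ℝ} {c : ℝ} (hc : 0 ≤ c) (hX : Xᵀ * C⁻¹ * X ≤ c • 1) {μ : p → ℝ}
    (hμ : 0 ≤ μ) :
    infoGain C (X * diagonal μ * Xᵀ) ≤ 1 / 2 * ∑ i, Real.log (1 + c * μ i) := by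
  set R : Matrix p p ℝ := diagonal fun i => √(μ i) with hR
  have hRR : R * R = diagonal μ := by
    simp [hR, diagonal_mul_diagonal, Real.mul_self_sqrt (hμ _)]
  have hRT : Rᵀ = R := diagonal_transpose _
  have hXR : (X * R)ᵀ * C⁻¹ * (X * R) = Rᵀ * (Xᵀ * C⁻¹ * X) * R := by
    simp only [transpose_mul, Matrix.mul_assoc]
  have hRcR : Rᵀ * c • 1 * R = diagonal fun i => c * μ i := by
    rw [hRT, Matrix.mul_smul, Matrix.mul_one, Matrix.smul_mul, hRR, ← diagonal_smul]
    rfl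
  calc infoGain C (X * diagonal μ * Xᵀ)
      = infoGain C ((X * R) * (X * R)ᵀ) := by
        rw [transpose_mul, hRT, ← hRR]
        simp only [Matrix.mul_assoc]
    _ = infoGain 1 (Rᵀ * (Xᵀ * C⁻¹ * X) * R) := by rw [infoGain_mul_transpose, hXR]
    _ ≤ infoGain 1 (Rᵀ * c • 1 * R) :=
        infoGain_le_infoGain_right PosDef.one
          (transpose_mul_mul_nonneg (transpose_mul_mul_nonneg hC.inv.posSemidef.nonneg X) R)
          (transpose_mul_mul_le_transpose_mul_mul hX R)
    _ = 1 / 2 * ∑ i, Real.log (1 + c * μ i) := by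
        rw [hRcR, infoGain_one_diagonal fun i => mul_nonneg hc (hμ i)]

theorem log_add_log_one_add_mul_sub {c t x : ℝ} (hc : 0 ≤ c) (ht : 0 ≤ t) (htx : t ≤ x) :
    Real.log (1 + t * c) + Real.log (1 + (1 + t * c)⁻¹ * c * (x - t)) = Real.log (1 + c * x) := by
  have ha : 0 < 1 + t * c := by positivity
  have : 0 ≤ (1 + t * c)⁻¹ * c * (x - t) := mul_nonneg (by positivity) (sub_nonneg.mpr htx)
  rw [← Real.log_mul ha.ne' (by positivity)]
  congr 1
  field_simp
  ring

/-- A signal of rank at most `card n` sees only the `card n` largest weights. The proof raises every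
weight outside `S` to the threshold `t`; this amounts to adding the isotropic signal `t c`, whose
gain is accounted for by the chain rule. -/
theorem infoGain_transpose_mul_diagonal_mul_le {M : Matrix p n ℝ} {c t : ℝ} (hc : 0 ≤ c)
    (hM : M * Mᵀ ≤ c • 1) {μ : p → ℝ} {S : Finset p} (hcard : S.card = Fintype.card n)
    (ht : 0 ≤ t) (hS : ∀ i ∈ S, t ≤ μ i) (hS' : ∀ i ∉ S, μ i ≤ t) (hμ : 0 ≤ μ) :
    infoGain 1 (Mᵀ * diagonal μ * M) ≤ 1 / 2 * ∑ i ∈ S, Real.log (1 + c * μ i) := by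
  set a : ℝ := 1 + t * c with ha
  have ha0 : 0 < a := by positivity
  set ν : p → ℝ := fun i => if i ∈ S then μ i - t else 0 with hν
  have hν0 : 0 ≤ ν := fun i => by by_cases hi : i ∈ S <;> simp [hν, hi, hS]
  have hμν : diagonal μ ≤ t • 1 + diagonal ν := by
    rw [smul_one_eq_diagonal, diagonal_add]
    exact diagonal_le_diagonal fun i => by by_cases hi : i ∈ S <;> simp [hν, hi, hS']
  have raised : Mᵀ * diagonal μ * M ≤ (t * c) • 1 + Mᵀ * diagonal ν * M :=
    calc Mᵀ * diagonal μ * M ≤ Mᵀ * (t • 1 + diagonal ν) * M :=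
          transpose_mul_mul_le_transpose_mul_mul hμν M
      _ = t • (Mᵀ * M) + Mᵀ * diagonal ν * M := by simp [Matrix.mul_add, Matrix.add_mul]
      _ ≤ t • c • 1 + Mᵀ * diagonal ν * M := add_le_add_left (smul_le_smul_of_nonneg_left
          (transpose_mul_self_le_of_mul_transpose_le hc hM) ht) _
      _ = (t * c) • 1 + Mᵀ * diagonal ν * M := by rw [smul_smul]
  have isotropic : infoGain 1 ((t * c) • (1 : Matrix n n ℝ)) = 1 / 2 * ∑ _i ∈ S, Real.log a := by
    rw [smul_one_eq_diagonal, infoGain_one_diagonal fun _ => mul_nonneg ht hc]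
    simp [ha, hcard]
  have excess : infoGain (a • 1) (Mᵀ * diagonal ν * M) ≤
      1 / 2 * ∑ i ∈ S, Real.log (1 + a⁻¹ * c * (μ i - t)) := by
    have hMa : Mᵀᵀ * (a • (1 : Matrix n n ℝ))⁻¹ * Mᵀ ≤ (a⁻¹ * c) • 1 := by
      simpa [inv_smul_one ha0.ne', mul_smul] using
        smul_le_smul_of_nonneg_left hM (inv_pos.mpr ha0).le
    have := infoGain_mul_diagonal_mul_transpose_le (PosDef.one.smul ha0) (by positivity) hMa hν0
    rw [transpose_transpose, ← Finset.sum_subset (Finset.subset_univ S)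
      (by simp +contextual [hν])] at this
    exact this.trans_eq (by simp +contextual [hν])
  calc infoGain 1 (Mᵀ * diagonal μ * M)
      ≤ infoGain 1 ((t * c) • 1 + Mᵀ * diagonal ν * M) := infoGain_le_infoGain_right PosDef.one
        (transpose_mul_mul_nonneg (diagonal_nonneg hμ) M) raised
    _ = infoGain 1 ((t * c) • 1) + infoGain (a • 1) (Mᵀ * diagonal ν * M) := by
        rw [infoGain_add PosDef.one (PosSemidef.one.smul (mul_nonneg ht hc)).nonneg
          (transpose_mul_mul_nonneg (diagonal_nonneg hν0) M), ha, add_smul, one_smul]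
    _ ≤ 1 / 2 * ∑ i ∈ S, (Real.log a + Real.log (1 + a⁻¹ * c * (μ i - t))) := by
        rw [isotropic, Finset.sum_add_distrib, mul_add]
        exact add_le_add_right excess _
    _ = 1 / 2 * ∑ i ∈ S, Real.log (1 + c * μ i) := by
        rw [Finset.sum_congr rfl fun i hi => log_add_log_one_add_mul_sub hc ht (hS i hi)]

end InfoGain

section Spectral

variable {d k l : ℕ} {ζ : Fin d → ℝ}

/-- The eigenvalues that `truncation` discards, with zeros at the first `k` positions. -/
def tail (ζ : Fin d → ℝ) (k : ℕ) : Fin d → ℝ :=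
  fun i => if i.val < k then 0 else ζ i

theorem tail_of_lt {i : Fin d} (h : i.val < k) : tail ζ k i = 0 :=
  if_pos h

theorem tail_of_le {i : Fin d} (h : k ≤ i.val) : tail ζ k i = ζ i :=
  if_neg h.not_gt

theorem tail_nonneg (hζ : 0 ≤ ζ) (k : ℕ) : 0 ≤ tail ζ k := fun i => by
  rcases lt_or_ge i.val k with hi | hi
  · exact (tail_of_lt hi).ge
  · exact (hζ i).trans_eq (tail_of_le hi).symm

theorem tail_le (hζ : 0 ≤ ζ) (k : ℕ) : tail ζ k ≤ ζ := fun i => by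
  rcases lt_or_ge i.val k with hi | hi
  · exact (tail_of_lt hi).trans_le (hζ i)
  · exact (tail_of_le hi).le

theorem sum_log_one_add_mul_tail (c : ℝ) (ζ : Fin d → ℝ) (k : ℕ) :
    ∑ i, Real.log (1 + c * tail ζ k i) =
      ∑ i : Fin d with k ≤ i.val, Real.log (1 + c * ζ i) := by
  rw [Finset.sum_filter]
  refine Finset.sum_congr rfl fun i _ => ?_
  split_ifs with hi
  · rw [tail_of_le hi]
  · simp [tail_of_lt (not_le.mp hi)]

theorem mul_diagonal_tail_mul_transpose_nonneg (U : Matrix (Fin d) (Fin d) ℝ) (hζ : 0 ≤ ζ)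
    (k : ℕ) : 0 ≤ U * diagonal (tail ζ k) * Uᵀ :=
  mul_mul_transpose_nonneg (diagonal_nonneg (tail_nonneg hζ k)) U

theorem truncation_eq (U : Matrix (Fin d) (Fin d) ℝ) (ζ : Fin d → ℝ) (hk : k ≤ d) :
    truncation U ζ hk = U * diagonal (ζ - tail ζ k) * Uᵀ := by
  ext a b
  rw [truncation, mul_apply, mul_apply]
  simp only [mul_diagonal, transpose_apply, submatrix_apply, id_eq, Pi.sub_apply]
  refine Fintype.sum_of_injective (Fin.castLE hk) (Fin.castLE_injective hk) _ _ ?_ ?_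
  · intro i hi
    have : k ≤ i.val := not_lt.mp fun hlt => hi ⟨⟨i, hlt⟩, rfl⟩
    simp [tail_of_le this]
  · intro i
    simp [tail_of_lt (show (Fin.castLE hk i).val < k from i.isLt)]

theorem truncation_nonneg (U : Matrix (Fin d) (Fin d) ℝ) (hζ : 0 ≤ ζ) (hk : k ≤ d) :
    0 ≤ truncation U ζ hk := by
  rw [truncation_eq]
  exact mul_mul_transpose_nonneg (diagonal_nonneg (sub_nonneg.mpr (tail_le hζ k))) U

theorem exists_truncation_eq_mul_transpose (U : Matrix (Fin d) (Fin d) ℝ) (hζ : 0 ≤ ζ)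
    (hk : k ≤ d) : ∃ X : Matrix (Fin d) (Fin k) ℝ, truncation U ζ hk = X * Xᵀ := by
  obtain ⟨Y, hY⟩ := exists_eq_mul_transpose_of_nonneg
    (diagonal_nonneg fun i : Fin k => hζ (Fin.castLE hk i))
  exact ⟨U.submatrix id (Fin.castLE hk) * Y, by
    rw [truncation, hY, transpose_mul]; simp only [Matrix.mul_assoc]⟩

namespace IsEigendecomposition

variable {H U : Matrix (Fin d) (Fin d) ℝ}

theorem mul_transpose (h : IsEigendecomposition H U ζ) : U * Uᵀ = 1 :=
  mul_eq_one_comm.mp h.orthogonal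

theorem nonneg (h : IsEigendecomposition H U ζ) (hH : 0 ≤ H) : 0 ≤ ζ := by
  have spectral : Uᵀ * H * U = diagonal ζ :=
    calc Uᵀ * H * U = (Uᵀ * U) * diagonal ζ * (Uᵀ * U) := by
          rw [h.eq]
          simp only [Matrix.mul_assoc]
      _ = diagonal ζ := by rw [h.orthogonal, Matrix.one_mul, Matrix.mul_one]
  have := transpose_mul_mul_nonneg hH U
  rwa [spectral, nonneg_iff_posSemidef, posSemidef_diagonal_iff] at this

theorem truncation_add_tail (h : IsEigendecomposition H U ζ) (hk : k ≤ d) :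
    truncation U ζ hk + U * diagonal (tail ζ k) * Uᵀ = H := by
  rw [truncation_eq, ← Matrix.add_mul, ← Matrix.mul_add, diagonal_add, h.eq]
  simp

theorem truncation_le [NeZero d] (h : IsEigendecomposition H U ζ) (hζ : 0 ≤ ζ) (hk : k ≤ d) :
    truncation U ζ hk ≤ ζ 0 • 1 :=
  calc truncation U ζ hk = U * diagonal (ζ - tail ζ k) * Uᵀ := truncation_eq U ζ hk
    _ ≤ U * (ζ 0 • 1) * Uᵀ := by
        rw [smul_one_eq_diagonal]
        exact mul_mul_transpose_le_mul_mul_transpose (diagonal_le_diagonal fun i =>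
          (sub_le_self _ (tail_nonneg hζ k i)).trans (h.antitone (Fin.zero_le i))) U
    _ = ζ 0 • 1 := by simp [h.mul_transpose]

end IsEigendecomposition

theorem infoGain_transpose_mul_diagonal_tail_mul_le {lam : Fin d → ℝ} (hlam : 0 ≤ lam)
    (hanti : Antitone lam) {M : Matrix (Fin d) (Fin k) ℝ} {c : ℝ} (hc : 0 ≤ c)
    (hM : M * Mᵀ ≤ c • 1) (l : ℕ) :
    infoGain 1 (Mᵀ * diagonal (tail lam l) * M) ≤
      1 / 2 * ∑ i : Fin d with l ≤ i.val ∧ i.val < l + k, Real.log (1 + c * lam i) := by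
  rcases lt_or_ge (l + k) d with hlk | hlk
  · set S : Finset (Fin d) := Finset.Ico ⟨l, by omega⟩ ⟨l + k, hlk⟩
    have mem_S (i : Fin d) : i ∈ S ↔ l ≤ i.val ∧ i.val < l + k := by
      simp [S, Fin.le_def, Fin.lt_def]
    have hS : ∀ i ∈ S, lam ⟨l + k, hlk⟩ ≤ tail lam l i := fun i hi => by
      obtain ⟨hli, hilk⟩ := (mem_S i).mp hi
      exact (hanti hilk.le).trans_eq (tail_of_le hli).symm
    have hS' : ∀ i ∉ S, tail lam l i ≤ lam ⟨l + k, hlk⟩ := fun i hi => by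
      rcases lt_or_ge i.val l with hli | hli
      · exact (tail_of_lt hli).trans_le (hlam _)
      · have : l + k ≤ i.val := not_lt.mp fun h => hi ((mem_S i).mpr ⟨hli, h⟩)
        exact (tail_of_le hli).trans_le (hanti this)
    refine (infoGain_transpose_mul_diagonal_mul_le hc hM (by simp [S]) (hlam _) hS hS'
      (tail_nonneg hlam l)).trans_eq ?_
    congr 1
    refine Finset.sum_congr (by ext i; simp [mem_S]) fun i hi => ?_
    rw [tail_of_le (Finset.mem_filter.mp hi).2.1]
  · have := infoGain_mul_diagonal_mul_transpose_le PosDef.one hc (X := Mᵀ) (by simpa using hM)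
      (tail_nonneg hlam l)
    rw [transpose_transpose, sum_log_one_add_mul_tail] at this
    refine this.trans_eq ?_
    congr 2
    ext i
    simp only [Finset.mem_filter, Finset.mem_univ, true_and]
    omega

variable {m : Type*} [Fintype m] [DecidableEq m] {C : Matrix m m ℝ} {W : Matrix m (Fin d) ℝ}
  {s : ℝ}

theorem infoGain_tail_le {U : Matrix (Fin d) (Fin d) ℝ} (hC : C.PosDef) (hs : 0 < s)
    (hWC : s • (W * Wᵀ) ≤ C) (hU : Uᵀ * U = 1) (hζ : 0 ≤ ζ) (k : ℕ) :
    infoGain C (W * (U * diagonal (tail ζ k) * Uᵀ) * Wᵀ) ≤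
      1 / 2 * ∑ i : Fin d with k ≤ i.val, Real.log (1 + ζ i / s) := by
  have hWU : (W * U)ᵀ * C⁻¹ * (W * U) ≤ s⁻¹ • 1 :=
    calc (W * U)ᵀ * C⁻¹ * (W * U) = Uᵀ * (Wᵀ * C⁻¹ * W) * U := by
          simp only [transpose_mul, Matrix.mul_assoc]
      _ ≤ Uᵀ * (s⁻¹ • 1) * U :=
          transpose_mul_mul_le_transpose_mul_mul (transpose_mul_inv_mul_le hC hs hWC) U
      _ = s⁻¹ • 1 := by simp [hU]
  have := infoGain_mul_diagonal_mul_transpose_le hC (inv_pos.mpr hs).le hWU (tail_nonneg hζ k)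
  rw [sum_log_one_add_mul_tail] at this
  simpa only [transpose_mul, Matrix.mul_assoc, div_eq_inv_mul] using this

theorem infoGain_le_infoGain_add_tail {V : Matrix (Fin d) (Fin d) ℝ} {lam : Fin d → ℝ}
    {X : Matrix (Fin d) (Fin k) ℝ} {z : ℝ} (hC : C.PosDef) (hs : 0 < s)
    (hWC : s • (W * Wᵀ) ≤ C) (hV : Vᵀ * V = 1) (hlam : 0 ≤ lam) (hanti : Antitone lam)
    (hz : 0 ≤ z) (hX : X * Xᵀ ≤ z • 1) (l : ℕ) :
    infoGain C (W * (X * Xᵀ) * Wᵀ) ≤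
      infoGain (C + W * (V * diagonal (tail lam l) * Vᵀ) * Wᵀ) (W * (X * Xᵀ) * Wᵀ) +
      1 / 2 * ∑ i : Fin d with l ≤ i.val ∧ i.val < l + k,
        Real.log (1 + lam i * z / s ^ 2) := by
  set K : Matrix (Fin d) (Fin d) ℝ := Wᵀ * C⁻¹ * W with hKdef
  have hK0 : 0 ≤ K := transpose_mul_mul_nonneg hC.inv.posSemidef.nonneg W
  have hKT : Kᵀ = K := by simpa using hK0.posSemidef.isHermitian.eq
  have hM : (Vᵀ * K * X) * (Vᵀ * K * X)ᵀ ≤ (z / s ^ 2) • 1 :=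
    calc (Vᵀ * K * X) * (Vᵀ * K * X)ᵀ = Vᵀ * (K * (X * Xᵀ) * K) * V := by
          rw [transpose_mul, transpose_mul, hKT, transpose_transpose]
          simp only [Matrix.mul_assoc]
      _ ≤ Vᵀ * ((z * s⁻¹ ^ 2) • 1) * V := transpose_mul_mul_le_transpose_mul_mul
          (mul_mul_self_le_of_le_smul_one hK0 (transpose_mul_inv_mul_le hC hs hWC)
            (inv_pos.mpr hs).le hX hz) V
      _ = (z / s ^ 2) • 1 := by simp [hV, div_eq_mul_inv]
  have linearized : (W * X)ᵀ * (C⁻¹ * (W * (V * diagonal (tail lam l) * Vᵀ) * Wᵀ) * C⁻¹) * (W * X)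
      = (Vᵀ * K * X)ᵀ * diagonal (tail lam l) * (Vᵀ * K * X) := by
    rw [transpose_mul (Vᵀ * K), transpose_mul Vᵀ, hKT]
    simp only [hKdef, transpose_mul, transpose_transpose, Matrix.mul_assoc]
  have gap : infoGain 1 ((Vᵀ * K * X)ᵀ * diagonal (tail lam l) * (Vᵀ * K * X)) ≤
      1 / 2 * ∑ i : Fin d with l ≤ i.val ∧ i.val < l + k,
        Real.log (1 + lam i * z / s ^ 2) := by
    simpa only [div_mul_eq_mul_div, mul_comm z] using
      infoGain_transpose_mul_diagonal_tail_mul_le hlam hanti (by positivity) hM l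
  have hWX : W * (X * Xᵀ) * Wᵀ = (W * X) * (W * X)ᵀ := by
    simp only [transpose_mul, Matrix.mul_assoc]
  rw [hWX]
  refine (infoGain_le_infoGain_add_infoGain_one hC (mul_mul_transpose_nonneg
    (mul_diagonal_tail_mul_transpose_nonneg V hlam l) W) (W * X)).trans ?_
  rw [linearized]
  exact add_le_add_right gap _

theorem abs_infoGain_sub_infoGain_truncation_le [NeZero d] {N H D U V : Matrix (Fin d) (Fin d) ℝ}
    {lam : Fin d → ℝ} (hs : 0 < s) (hN : s • 1 ≤ N) (hH : 0 ≤ H) (hD : 0 ≤ D)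
    (hU : IsEigendecomposition H U ζ) (hV : IsEigendecomposition D V lam) (hk : k ≤ d)
    (hl : l ≤ d) (hW : LinearIndependent ℝ W.row) :
    |infoGain (W * (N + D) * Wᵀ) (W * H * Wᵀ) -
        infoGain (W * (N + truncation V lam hl) * Wᵀ) (W * truncation U ζ hk * Wᵀ)| ≤
      1 / 2 * ∑ i : Fin d with k ≤ i.val, Real.log (1 + ζ i / s) +
      1 / 2 * ∑ i : Fin d with l ≤ i.val ∧ i.val < l + k,
        Real.log (1 + lam i * ζ 0 / s ^ 2) := by
  have hζ := hU.nonneg hH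
  have hlam := hV.nonneg hD
  have hNl : s • 1 ≤ N + truncation V lam hl :=
    hN.trans (le_add_of_nonneg_right (truncation_nonneg V hlam hl))
  have hC : (W * (N + truncation V lam hl) * Wᵀ).PosDef := by
    simpa using (posDef_of_le (PosDef.one.smul hs) hNl).mul_mul_conjTranspose_same
      (vecMul_injective_iff.mpr hW)
  have hWC : s • (W * Wᵀ) ≤ W * (N + truncation V lam hl) * Wᵀ := by
    simpa using mul_mul_transpose_le_mul_mul_transpose hNl W
  have tail_split {A Q : Matrix (Fin d) (Fin d) ℝ} {μ : Fin d → ℝ} {j : ℕ}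
      (h : IsEigendecomposition A Q μ) (hj : j ≤ d) :
      W * A * Wᵀ = W * truncation Q μ hj * Wᵀ + W * (Q * diagonal (tail μ j) * Qᵀ) * Wᵀ := by
    rw [← Matrix.add_mul, ← Matrix.mul_add, h.truncation_add_tail]
  have noise_split : W * (N + D) * Wᵀ = W * (N + truncation V lam hl) * Wᵀ +
      W * (V * diagonal (tail lam l) * Vᵀ) * Wᵀ := by
    simp only [Matrix.mul_add, Matrix.add_mul, tail_split hV hl, add_assoc]
  obtain ⟨X, hX⟩ := exists_truncation_eq_mul_transpose U hζ hk
  rw [noise_split, tail_split hU hk]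
  refine abs_infoGain_add_sub_infoGain_le hC (mul_mul_transpose_nonneg
    (mul_diagonal_tail_mul_transpose_nonneg V hlam l) W)
    (mul_mul_transpose_nonneg (truncation_nonneg U hζ hk) W) (mul_mul_transpose_nonneg
    (mul_diagonal_tail_mul_transpose_nonneg U hζ k) W)
    (infoGain_tail_le hC hs hWC hU.orthogonal hζ k) ?_
  rw [hX]
  exact infoGain_le_infoGain_add_tail hC hs hWC hV.orthogonal hlam hV.antitone (hζ 0)
    (hX ▸ hU.truncation_le hζ hk) l

end Spectral

section Model

variable {d dm dρ r : ℕ}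

theorem IsDesign.mul_transpose {W : Matrix (Fin r) (Fin d) ℝ} (hW : IsDesign W) :
    W * Wᵀ = 1 := by
  ext i i'
  simp only [mul_apply, transpose_apply]
  rcases eq_or_ne i i' with rfl | hne
  · rw [one_apply_eq, ← hW.row_sum i]
    exact Finset.sum_congr rfl fun j _ => by rcases hW.entry i j with h | h <;> simp [h]
  · rw [one_apply_ne hne]
    refine Finset.sum_eq_zero fun j _ => ?_
    have entry_nonneg (a : Fin r) : 0 ≤ W a j := by rcases hW.entry a j with h | h <;> simp [h]
    have pair_le_sum := Finset.add_le_sum (fun a _ => entry_nonneg a) (Finset.mem_univ i)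
      (Finset.mem_univ i') hne
    rcases hW.entry i j with h | h
    · simp [h]
    rcases hW.entry i' j with h' | h'
    · simp [h']
    rcases hW.col_sum j with hj | hj <;> linarith

theorem IsDesign.linearIndependent_row {W : Matrix (Fin r) (Fin d) ℝ} (hW : IsDesign W) :
    LinearIndependent ℝ W.row :=
  vecMul_injective_iff.mp <| Function.LeftInverse.injective (g := (· ᵥ* Wᵀ)) fun v => by
    simp [hW.mul_transpose]

theorem sigmaMinSq_pos [NeZero d] {σ : Fin d → ℝ} (hσ : ∀ i, σ i ≠ 0) : 0 < sigmaMinSq σ := by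
  simpa only [sigmaMinSq, Finset.lt_inf'_iff] using fun i _ => sq_pos_of_ne_zero (hσ i)

theorem sigmaMinSq_smul_one_le [NeZero d] (σ : Fin d → ℝ) : sigmaMinSq σ • 1 ≤ noiseCov σ := by
  rw [smul_one_eq_diagonal, noiseCov]
  exact diagonal_le_diagonal fun i => Finset.inf'_le _ (Finset.mem_univ i)

variable {Fd : Matrix (Fin d) (Fin dm) ℝ} {Γpr : Matrix (Fin dm) (Fin dm) ℝ}
  {P : Matrix (Fin dρ) (Fin dm) ℝ}

theorem Pdagger_mul_qoiPriorCov (hSpr : (qoiPriorCov Γpr P).PosDef) :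
    Pdagger Γpr P * qoiPriorCov Γpr P = Γpr * Pᵀ :=
  nonsing_inv_mul_cancel_right _ _ (isUnit_det_of_posDef hSpr)

theorem Hdρ_eq (hΓpr : Γpr.PosSemidef) (hSpr : (qoiPriorCov Γpr P).PosDef) :
    Hdρ Fd Γpr P = Fd * Pdagger Γpr P * qoiPriorCov Γpr P * (Fd * Pdagger Γpr P)ᵀ := by
  have hΓT : Γprᵀ = Γpr := by simpa using hΓpr.isHermitian.eq
  rw [Matrix.mul_assoc Fd, Pdagger_mul_qoiPriorCov hSpr]
  simp only [Hdρ, Pdagger, transpose_mul, transpose_transpose, hΓT, transpose_inv_of_posDef hSpr,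
    Matrix.mul_assoc]

theorem Hdρ_nonneg (hΓpr : Γpr.PosSemidef) (hSpr : (qoiPriorCov Γpr P).PosDef) :
    0 ≤ Hdρ Fd Γpr P := by
  rw [Hdρ_eq hΓpr hSpr]
  exact mul_mul_transpose_nonneg hSpr.posSemidef.nonneg _

theorem conditionalCov_nonneg (hΓpr : Γpr.PosSemidef) (hSpr : (qoiPriorCov Γpr P).PosDef) :
    0 ≤ Γpr - Γpr * Pᵀ * (qoiPriorCov Γpr P)⁻¹ * P * Γpr := by
  obtain ⟨Y, rfl⟩ := exists_eq_mul_transpose_of_nonneg hΓpr.nonneg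
  -- For `Z = (P Y)ᵀ` the claim reads `0 ≤ Y (1 - Z (Zᵀ Z)⁻¹ Zᵀ) Yᵀ`, with a projection inside.
  set S := qoiPriorCov (Y * Yᵀ) P with hS
  have gram : (P * Y)ᵀᵀ * (1 : Matrix (Fin dm) (Fin dm) ℝ)⁻¹ * (P * Y)ᵀ ≤ S := by
    simp [hS, qoiPriorCov, Matrix.mul_assoc]
  have projection_le := (mul_inv_mul_transpose_le_iff PosDef.one hSpr _).mpr gram
  have := mul_mul_transpose_le_mul_mul_transpose projection_le Y
  rw [sub_nonneg]
  simpa only [transpose_mul, transpose_transpose, Matrix.mul_one, Matrix.mul_assoc] using this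

theorem ΔHd_eq (Fd : Matrix (Fin d) (Fin dm) ℝ) (Γpr : Matrix (Fin dm) (Fin dm) ℝ)
    (P : Matrix (Fin dρ) (Fin dm) ℝ) :
    ΔHd Fd Γpr P = Fd * (Γpr - Γpr * Pᵀ * (qoiPriorCov Γpr P)⁻¹ * P * Γpr) * Fdᵀ := by
  simp only [ΔHd, Hd, Hdρ, Matrix.mul_sub, Matrix.sub_mul, Matrix.mul_assoc]

theorem ΔHd_nonneg (hΓpr : Γpr.PosSemidef) (hSpr : (qoiPriorCov Γpr P).PosDef) :
    0 ≤ ΔHd Fd Γpr P := by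
  rw [ΔHd_eq]
  exact mul_mul_transpose_nonneg (conditionalCov_nonneg hΓpr hSpr) Fd

theorem etaCov_eq (σ : Fin d → ℝ) (W : Matrix (Fin r) (Fin d) ℝ) :
    etaCov Fd Γpr P σ W = W * (noiseCov σ + ΔHd Fd Γpr P) * Wᵀ := by
  rw [etaCov, ΔHd_eq, transpose_mul, Matrix.mul_add, Matrix.add_mul]
  simp only [Matrix.mul_assoc]

theorem eig_eq_infoGain (hΓpr : Γpr.PosSemidef) (hSpr : (qoiPriorCov Γpr P).PosDef)
    (σ : Fin d → ℝ) (W : Matrix (Fin r) (Fin d) ℝ) :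
    eig Fd Γpr P σ W = infoGain (etaCov Fd Γpr P σ W) (W * Hdρ Fd Γpr P * Wᵀ) := by
  set S := qoiPriorCov Γpr P with hS
  set C := etaCov Fd Γpr P σ W
  set R := CFC.sqrt S
  set G := W * Fd * Pdagger Γpr P with hG
  have hRR : R * R = S := CFC.sqrt_mul_sqrt_self S hSpr.posSemidef.nonneg
  have signal : G * S * Gᵀ = W * Hdρ Fd Γpr P * Wᵀ := by
    rw [Hdρ_eq hΓpr hSpr]
    simp only [hG, hS, transpose_mul, Matrix.mul_assoc]
  calc eig Fd Γpr P σ W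
      = 1 / 2 * Real.log (1 + R * (Gᵀ * C⁻¹ * G) * R).det := rfl
    _ = 1 / 2 * Real.log (1 + (R * Gᵀ) * (C⁻¹ * G * R)).det := by simp only [Matrix.mul_assoc]
    _ = infoGain C (G * (R * R) * Gᵀ) := by
        rw [det_one_add_mul_comm, infoGain]
        simp only [Matrix.mul_assoc]
    _ = infoGain C (W * Hdρ Fd Γpr P * Wᵀ) := by rw [hRR, signal]

theorem eigApprox_eq_infoGain {C L : Matrix (Fin r) (Fin r) ℝ} (hL : C⁻¹ = L * Lᵀ)
    (H : Matrix (Fin d) (Fin d) ℝ) (W : Matrix (Fin r) (Fin d) ℝ) :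
    eigApprox H L W = infoGain C (W * H * Wᵀ) :=
  calc eigApprox H L W = 1 / 2 * Real.log (1 + Lᵀ * (W * H * Wᵀ * L)).det := by
        simp only [eigApprox, Matrix.mul_assoc]
    _ = 1 / 2 * Real.log (1 + W * H * Wᵀ * (L * Lᵀ)).det := by
        rw [det_one_add_mul_comm, Matrix.mul_assoc _ L]
    _ = infoGain C (W * H * Wᵀ) := by rw [← hL, det_one_add_mul_comm, infoGain]

end Model

end GOOED

theorem theorem3p2_general {d dm dρ r k l : ℕ} [NeZero d]
    (Fd : Matrix (Fin d) (Fin dm) ℝ) (Γpr : Matrix (Fin dm) (Fin dm) ℝ)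
    (P : Matrix (Fin dρ) (Fin dm) ℝ) (σ : Fin d → ℝ)
    (hΓpr : Γpr.PosSemidef) (hSpr : (GOOED.qoiPriorCov Γpr P).PosDef) (hσ : ∀ i, σ i ≠ 0)
    (U V : Matrix (Fin d) (Fin d) ℝ) (ζ lam : Fin d → ℝ)
    (hU : GOOED.IsEigendecomposition (GOOED.Hdρ Fd Γpr P) U ζ)
    (hV : GOOED.IsEigendecomposition (GOOED.ΔHd Fd Γpr P) V lam)
    (hk : k ≤ d) (hl : l ≤ d)
    (W : Matrix (Fin r) (Fin d) ℝ) (hW : LinearIndependent ℝ W.row)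
    (Lhat : Matrix (Fin r) (Fin r) ℝ)
    (hLhat : (GOOED.etaCovApprox σ (GOOED.truncation V lam hl) W)⁻¹ = Lhat * Lhat.transpose) :
    |GOOED.eig Fd Γpr P σ W - GOOED.eigApprox (GOOED.truncation U ζ hk) Lhat W| ≤
      1 / 2 * ∑ i : Fin d with k ≤ i.val, Real.log (1 + ζ i / GOOED.sigmaMinSq σ)
      + 1 / 2 * ∑ i : Fin d with l ≤ i.val ∧ i.val < l + k,
          Real.log (1 + lam i * ζ 0 / GOOED.sigmaMinSq σ ^ 2) := by
  rw [GOOED.eig_eq_infoGain hΓpr hSpr, GOOED.etaCov_eq, GOOED.eigApprox_eq_infoGain hLhat,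
    GOOED.etaCovApprox]
  exact GOOED.abs_infoGain_sub_infoGain_truncation_le (GOOED.sigmaMinSq_pos hσ)
    (GOOED.sigmaMinSq_smul_one_le σ) (GOOED.Hdρ_nonneg hΓpr hSpr) (GOOED.ΔHd_nonneg hΓpr hSpr)
    hU hV hk hl hW

/-- Indices are 0-based: `ζ i` for `i : Fin d` is the `(i+1)`-st largest eigenvalue, so the first
sum is over the positions `k+1, …, d` and the second over `l+1, …, min(l+k, d)`. `Lhat` is any
factor of `Γ̂_η(W)⁻¹`, in particular the Cholesky factor. -/
theorem theorem3p2 {d dm dρ r k l : ℕ} [NeZero d]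
    (Fd : Matrix (Fin d) (Fin dm) ℝ) (Γpr : Matrix (Fin dm) (Fin dm) ℝ)
    (P : Matrix (Fin dρ) (Fin dm) ℝ) (σ : Fin d → ℝ)
    (hΓpr : Γpr.PosDef) (hSpr : (GOOED.qoiPriorCov Γpr P).PosDef) (hσ : ∀ i, 0 < σ i)
    (U V : Matrix (Fin d) (Fin d) ℝ) (ζ lam : Fin d → ℝ)
    (hU : GOOED.IsEigendecomposition (GOOED.Hdρ Fd Γpr P) U ζ)
    (hV : GOOED.IsEigendecomposition (GOOED.ΔHd Fd Γpr P) V lam)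
    (hk : k ≤ d) (hl : l ≤ d)
    (W : Matrix (Fin r) (Fin d) ℝ) (hW : GOOED.IsDesign W)
    (Lhat : Matrix (Fin r) (Fin r) ℝ)
    (hLhat : (GOOED.etaCovApprox σ (GOOED.truncation V lam hl) W)⁻¹ = Lhat * Lhat.transpose) :
    |GOOED.eig Fd Γpr P σ W - GOOED.eigApprox (GOOED.truncation U ζ hk) Lhat W| ≤
      1 / 2 * ∑ i : Fin d with k ≤ i.val, Real.log (1 + ζ i / GOOED.sigmaMinSq σ)
      + 1 / 2 * ∑ i : Fin d with l ≤ i.val ∧ i.val < l + k,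
          Real.log (1 + lam i * ζ 0 / GOOED.sigmaMinSq σ ^ 2) :=
  theorem3p2_general Fd Γpr P σ hΓpr.posSemidef hSpr (fun i => (hσ i).ne') U V ζ lam hU hV hk hl W
    hW.linearIndependent_row Lhat hLhat
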